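/- Let $H\neq\{0\}$ be a complex separable Hilbert space. Let $\mathcal T_s(H)$ be the real vector space of self-adjoint trace-class operators on $H$, $\mathcal B_s(H)$ the real vector space of bounded self-adjoint operators, $\mathcal S(H)\subseteq\mathcal T_s(H)$ the set of density operators (positive trace-class operators of trace $1$), and $\mathcal P(H)$ the set of pure states, i.e. of the one-dimensional orthogonal projections $|\varphi\rangle\langle\varphi|$, $\|\varphi\|=1$. For a measurable space $(\Omega,\Sigma)$ let $\mathcal M_{\mathbb R}(\Omega,\Sigma)$ be the real vector space of real-valued ($\sigma$-additive) measures, $\mathcal S(\Omega,\Sigma)$ its subset of probability measures, $\mathcal F_{\mathbb R}(\Omega,\Sigma)$ the space of bounded measurable real functions, and $\delta_\omega$ the Dirac measure at $\omega\in\Omega$. Let $\sigma(\mathcal M_{\mathbb R},\mathcal F_{\mathbb R})$ be the coarsest topology on $\mathcal M_{\mathbb R}(\Omega,\Sigma)$ making all functionals $\nu\mapsto\int f\,d\nu$, $f\in\mathcal F_{\mathbb R}(\Omega,\Sigma)$, continuous, and $\sigma(\mathcal T_s,\mathcal B_s)$ the coarsest topology on $\mathcal T_s(H)$ making all functionals $V\mapsto\operatorname{tr}(VA)$,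 $A\in\mathcal B_s(H)$, continuous. A linear map $R:\mathcal M_{\mathbb R}(\Omega,\Sigma)\to\mathcal T_s(H)$ is called a reduction map if $R\,\mathcal S(\Omega,\Sigma)=\mathcal S(H)$ and $R$ is $\sigma(\mathcal M_{\mathbb R},\mathcal F_{\mathbb R})$-$\sigma(\mathcal T_s,\mathcal B_s)$-continuous. Theorem. Let $R:\mathcal M_{\mathbb R}(\Omega,\Sigma)\to\mathcal T_s(H)$ be a reduction map. Then the set $\widetilde\Omega:=\{\omega\in\Omega : R\delta_\omega\in\mathcal P(H)\}$ is measurable. Let $\widetilde\Sigma:=\Sigma\cap\widetilde\Omega$, let $\mathcal N$ be the space of all $\nu\in\mathcal M_{\mathbb R}(\Omega,\Sigma)$ with $\nu(E)=0$ for all $E\in\Sigma$, $E\subseteq\Omega\setminus\widetilde\Omega$, let $J:\mathcal N\to\mathcal M_{\mathbb R}(\widetilde\Omega,\widetilde\Sigma)$, $J\nu:=\nu|_{\widetilde\Sigma}$, which is a linear isomorphism, and let $\widetilde R:=RJ^{-1}:\mathcal M_{\mathbb R}(\widetilde\Omega,\widetilde\Sigma)\to\mathcal T_s(H)$. Then (i)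 $\widetilde R\,\mathcal S(\widetilde\Omega,\widetilde\Sigma)=\mathcal S(H)$; (ii) $\widetilde R$ is $\sigma(\mathcal M_{\mathbb R}(\widetilde\Omega,\widetilde\Sigma),\mathcal F_{\mathbb R}(\widetilde\Omega,\widetilde\Sigma))$-$\sigma(\mathcal T_s(H),\mathcal B_s(H))$-continuous; (iii) $\{\widetilde R\,\widetilde\delta_\omega : \omega\in\widetilde\Omega\}=\mathcal P(H)$, where $\widetilde\delta_\omega$ is the restriction of $\delta_\omega$ to $\widetilde\Sigma$. That is, $\widetilde R$ is a reduction map with the additional property (iii). -/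

import Mathlib

namespace ClassicalExtension

open MeasureTheory ContinuousLinearMap Topology

set_option linter.unusedSectionVars false

section Parseval

variable {H : Type*} [NormedAddCommGroup H] [InnerProductSpace ℂ H]

/-- Parseval's identity in extended form. -/
theorem tsum_enorm_inner_sq {ι : Type*} (b : HilbertBasis ι ℂ H) (x : H) :
    ∑' i, ‖inner ℂ (b i) x‖ₑ ^ 2 = ‖x‖ₑ ^ 2 := by
  have h := (b.hasSum_inner_mul_inner x x).mapL Complex.reCLM
  have h1 : HasSum (fun i => ‖inner ℂ (b i) x‖ ^ 2) (‖x‖ ^ 2) := by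
    convert h using 1
    · funext i
      rw [← inner_conj_symm x (b i)]
      simp only [Complex.reCLM_apply]
      rw [mul_comm, Complex.mul_conj, Complex.normSq_eq_norm_sq, Complex.ofReal_re]
    · simp [inner_self_eq_norm_sq_to_K, ← Complex.ofReal_pow]
  have e : ∀ r : ℝ, 0 ≤ r → ENNReal.ofReal (r ^ 2) = ENNReal.ofReal r ^ 2 :=
    fun r hr => ENNReal.ofReal_pow hr 2
  have h2 := ENNReal.ofReal_tsum_of_nonneg (fun i => sq_nonneg ‖inner ℂ (b i) x‖) h1.summable
  rw [h1.tsum_eq, e _ (norm_nonneg _), ofReal_norm] at h2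
  rw [h2]
  exact tsum_congr fun i => by rw [e _ (norm_nonneg _), ofReal_norm]

variable [CompleteSpace H]

/-- The sum `∑ ‖S eᵢ‖²` does not change when `S` is replaced by its adjoint and the
orthonormal basis by another one. -/
theorem tsum_enorm_sq_adjoint {ι κ : Type*} (b : HilbertBasis ι ℂ H) (c : HilbertBasis κ ℂ H)
    (S : H →L[ℂ] H) :
    ∑' i, ‖S (b i)‖ₑ ^ 2 = ∑' j, ‖(adjoint S) (c j)‖ₑ ^ 2 := by
  calc ∑' i, ‖S (b i)‖ₑ ^ 2 = ∑' i, ∑' j, ‖inner ℂ (c j) (S (b i))‖ₑ ^ 2 :=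
        tsum_congr fun i => (tsum_enorm_inner_sq c _).symm
    _ = ∑' j, ∑' i, ‖inner ℂ (c j) (S (b i))‖ₑ ^ 2 := ENNReal.tsum_comm
    _ = ∑' j, ∑' i, ‖inner ℂ (b i) (adjoint S (c j))‖ₑ ^ 2 := by
        refine tsum_congr fun j => tsum_congr fun i => ?_
        rw [← adjoint_inner_left, ← ofReal_norm, ← ofReal_norm, norm_inner_symm]
    _ = _ := tsum_congr fun j => tsum_enorm_inner_sq b _

theorem tsum_enorm_sq_basis {ι κ : Type*} (b : HilbertBasis ι ℂ H) (c : HilbertBasis κ ℂ H)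
    (S : H →L[ℂ] H) : ∑' i, ‖S (b i)‖ₑ ^ 2 = ∑' j, ‖S (c j)‖ₑ ^ 2 := by
  rw [tsum_enorm_sq_adjoint b c, tsum_enorm_sq_adjoint c c S]

/-- The extended trace `∑ ⟨eᵢ, A eᵢ⟩ ∈ [0, ∞]` of a positive operator. -/
noncomputable def etrace {ι : Type*} (b : HilbertBasis ι ℂ H) (A : H →L[ℂ] H) : ENNReal :=
  ∑' i, ENNReal.ofReal (inner ℂ (b i) (A (b i))).re

theorem inner_conj_sqrt {A : H →L[ℂ] H} (hA : 0 ≤ A) (x y : H) :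
    inner ℂ x (A y) = inner ℂ (CFC.sqrt A x) (CFC.sqrt A y) := by
  have h1 : CFC.sqrt A * CFC.sqrt A = A := CFC.sqrt_mul_sqrt_self A hA
  have h2 : adjoint (CFC.sqrt A) = CFC.sqrt A :=
    (IsSelfAdjoint.of_nonneg (CFC.sqrt_nonneg A)).adjoint_eq
  calc inner ℂ x (A y) = inner ℂ x ((CFC.sqrt A * CFC.sqrt A) y) := by rw [h1]
    _ = inner ℂ (adjoint (CFC.sqrt A) x) (CFC.sqrt A y) := by
        rw [adjoint_inner_left]; rfl
    _ = _ := by rw [h2]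

theorem ofReal_re_inner_self (x : H) : ENNReal.ofReal (inner ℂ x x).re = ‖x‖ₑ ^ 2 := by
  have : (inner ℂ x x).re = ‖x‖ ^ 2 := inner_self_eq_norm_sq (𝕜 := ℂ) x
  rw [this, ENNReal.ofReal_pow (norm_nonneg _), ofReal_norm]

theorem etrace_eq {ι : Type*} (b : HilbertBasis ι ℂ H) {A : H →L[ℂ] H} (hA : 0 ≤ A) :
    etrace b A = ∑' i, ‖(CFC.sqrt A) (b i)‖ₑ ^ 2 :=
  tsum_congr fun i => by rw [inner_conj_sqrt hA, ofReal_re_inner_self]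

theorem etrace_basis {ι κ : Type*} (b : HilbertBasis ι ℂ H) (c : HilbertBasis κ ℂ H)
    {A : H →L[ℂ] H} (hA : 0 ≤ A) : etrace b A = etrace c A := by
  rw [etrace_eq b hA, etrace_eq c hA, tsum_enorm_sq_basis b c]

theorem etrace_mono {ι : Type*} (b : HilbertBasis ι ℂ H) {A B : H →L[ℂ] H} (h : A ≤ B) :
    etrace b A ≤ etrace b B := by
  refine ENNReal.tsum_le_tsum fun i => ENNReal.ofReal_le_ofReal ?_
  have h1 : 0 ≤ (inner ℂ (b i) ((B - A) (b i))).re :=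
    ((ContinuousLinearMap.le_def A B).1 h).re_inner_nonneg_right (b i)
  rw [sub_apply, inner_sub_right, Complex.sub_re] at h1
  linarith

theorem etrace_add_le {ι : Type*} (b : HilbertBasis ι ℂ H) (A B : H →L[ℂ] H) :
    etrace b (A + B) ≤ etrace b A + etrace b B := by
  unfold etrace
  rw [← ENNReal.tsum_add]
  refine ENNReal.tsum_le_tsum fun i => ?_
  rw [add_apply, inner_add_right, Complex.add_re]
  exact ENNReal.ofReal_add_le

theorem etrace_conj_le {ι : Type*} (b : HilbertBasis ι ℂ H) {A : H →L[ℂ] H} (hA : 0 ≤ A)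
    {P : H →L[ℂ] H} (hP : adjoint P = P) (hP1 : ‖P‖ ≤ 1) :
    etrace b (P * A * P) ≤ etrace b A := by
  set S := CFC.sqrt A with hS
  have hS2 : adjoint S = S := (IsSelfAdjoint.of_nonneg (CFC.sqrt_nonneg A)).adjoint_eq
  calc etrace b (P * A * P) = ∑' i, ‖(S * P) (b i)‖ₑ ^ 2 := by
        refine tsum_congr fun i => ?_
        rw [← ofReal_re_inner_self]
        have : (P * A * P) (b i) = P (A (P (b i))) := rfl
        rw [this, ← adjoint_inner_left, hP, inner_conj_sqrt hA]
        rfl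
    _ = ∑' i, ‖(P * S) (b i)‖ₑ ^ 2 := by
        rw [tsum_enorm_sq_adjoint b b]
        have : adjoint (S * P) = P * S := by
          change adjoint (S ∘L P) = _
          rw [adjoint_comp, hP, hS2]; rfl
        rw [this]
    _ ≤ ∑' i, ‖S (b i)‖ₑ ^ 2 := by
        refine ENNReal.tsum_le_tsum fun i => ?_
        gcongr
        rw [← ofReal_norm, ← ofReal_norm]
        refine ENNReal.ofReal_le_ofReal ?_
        calc ‖(P * S) (b i)‖ ≤ ‖P‖ * ‖S (b i)‖ := P.le_opNorm _
          _ ≤ 1 * ‖S (b i)‖ := by gcongr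
          _ = _ := one_mul _
    _ = _ := (etrace_eq b hA).symm

theorem etrace_le_of_sub_eq {ι : Type*} (b : HilbertBasis ι ℂ H) {X Y A B : H →L[ℂ] H}
    (hX : 0 ≤ X) (hA : 0 ≤ A) (hB : 0 ≤ B) (hYX : Y * X = 0)
    (h : X - Y = A - B) : etrace b X ≤ etrace b A := by
  have hc : IsClosed (LinearMap.ker (Y : H →ₗ[ℂ] H) : Set H) := Y.isClosed_ker
  have : CompleteSpace (LinearMap.ker (Y : H →ₗ[ℂ] H)) := hc.completeSpace_coe
  set K := LinearMap.ker (Y : H →ₗ[ℂ] H) with hK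
  set P : H →L[ℂ] H := K.starProjection with hPdef
  have hP : adjoint P = P := (isSelfAdjoint_starProjection K).adjoint_eq
  have hP1 : ‖P‖ ≤ 1 := K.starProjection_norm_le
  have hYP : Y * P = 0 := by
    ext x
    exact LinearMap.mem_ker.1 (K.starProjection_apply_mem x)
  have hPX : P * X = X := by
    ext x
    refine Submodule.starProjection_eq_self_iff.2 (LinearMap.mem_ker.2 ?_)
    exact congrArg (fun T : H →L[ℂ] H => T x) hYX
  have hXP : X * P = X := by
    have h1 := congrArg star hPX
    rw [star_mul, star_eq_adjoint P, hP, (IsSelfAdjoint.of_nonneg hX).star_eq] at h1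
    exact h1
  have hXeq : X = P * A * P - P * B * P := by
    calc X = P * X * P := by rw [hPX, hXP]
      _ = P * (A - B + Y) * P := by rw [← h]; congr 2; abel
      _ = P * A * P - P * B * P + P * (Y * P) := by noncomm_ring
      _ = _ := by rw [hYP]; simp
  have hPB : 0 ≤ P * B * P := by
    have := star_left_conjugate_nonneg hB P
    rwa [star_eq_adjoint, hP] at this
  refine (etrace_mono b (B := P * A * P) ?_).trans (etrace_conj_le b hA hP hP1)
  rw [hXeq]
  exact sub_le_self _ hPB

end Parseval

section Quantum

variable (H : Type*) [NormedAddCommGroup H] [InnerProductSpace ℂ H] [CompleteSpace H]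

/-- The index set of an orthonormal basis of `H`, fixed once and for all. -/
noncomputable def stdIndex : Set H := (exists_hilbertBasis ℂ H).choose

/-- An orthonormal basis of `H`, fixed once and for all. -/
noncomputable def stdBasis : HilbertBasis (stdIndex H) ℂ H :=
  (exists_hilbertBasis ℂ H).choose_spec.choose

variable {H}

/-- `T` is of trace class if `tr |T| = ∑ ⟨eᵢ, |T| eᵢ⟩` is finite, where `|T| = √(T* T)`.
By `isTraceClass_iff` this does not depend on the orthonormal basis. -/
def IsTraceClass (T : H →L[ℂ] H) : Prop :=
  Summable fun i => (inner ℂ (stdBasis H i) (CFC.abs T (stdBasis H i))).re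

/-- The trace `tr T = ∑ ⟨eᵢ, T eᵢ⟩`. By `hasSum_trace_mul` it does not depend on the orthonormal
basis, for the products `V A` to which it is applied. -/
noncomputable def trace (T : H →L[ℂ] H) : ℂ :=
  ∑' i, inner ℂ (stdBasis H i) (T (stdBasis H i))

theorem summable_iff_etrace {ι : Type*} (b : HilbertBasis ι ℂ H) {A : H →L[ℂ] H} (hA : 0 ≤ A) :
    (Summable fun i => (inner ℂ (b i) (A (b i))).re) ↔ etrace b A ≠ ⊤ := by
  have hn : ∀ i, 0 ≤ (inner ℂ (b i) (A (b i))).re := fun i =>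
    ((nonneg_iff_isPositive A).1 hA).re_inner_nonneg_right (b i)
  constructor
  · intro h
    exact h.tsum_ofReal_ne_top
  · intro h
    have := ENNReal.summable_toReal h
    simpa only [ENNReal.toReal_ofReal (hn _)] using this

theorem isTraceClass_iff {ι : Type*} (b : HilbertBasis ι ℂ H) (T : H →L[ℂ] H) :
    IsTraceClass T ↔ Summable fun i => (inner ℂ (b i) (CFC.abs T (b i))).re := by
  unfold IsTraceClass
  rw [summable_iff_etrace _ (CFC.abs_nonneg T), summable_iff_etrace _ (CFC.abs_nonneg T),
    etrace_basis b (stdBasis H) (CFC.abs_nonneg T)]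

theorem exists_parts {T : H →L[ℂ] H} (hT : IsSelfAdjoint T) :
    ∃ X Y : H →L[ℂ] H, 0 ≤ X ∧ 0 ≤ Y ∧ X * Y = 0 ∧ Y * X = 0 ∧ X - Y = T ∧ CFC.abs T = X + Y :=
  ⟨T⁺, T⁻, CFC.posPart_nonneg T, CFC.negPart_nonneg T, CFC.posPart_mul_negPart T,
    CFC.negPart_mul_posPart T, CFC.posPart_sub_negPart T hT, (CFC.posPart_add_negPart T hT).symm⟩

theorem isTraceClass_iff_parts {T X Y : H →L[ℂ] H} (hX : 0 ≤ X) (hY : 0 ≤ Y)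
    (habs : CFC.abs T = X + Y) :
    IsTraceClass T ↔ etrace (stdBasis H) X ≠ ⊤ ∧ etrace (stdBasis H) Y ≠ ⊤ := by
  rw [IsTraceClass, summable_iff_etrace _ (CFC.abs_nonneg T), habs]
  constructor
  · intro h
    exact ⟨ne_top_of_le_ne_top h (etrace_mono _ (le_add_of_nonneg_right hY)),
      ne_top_of_le_ne_top h (etrace_mono _ (le_add_of_nonneg_left hX))⟩
  · rintro ⟨h1, h2⟩
    exact ne_top_of_le_ne_top (ENNReal.add_ne_top.2 ⟨h1, h2⟩) (etrace_add_le _ _ _)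

theorem IsTraceClass.add {T₁ T₂ : H →L[ℂ] H} (s₁ : IsSelfAdjoint T₁) (s₂ : IsSelfAdjoint T₂)
    (h₁ : IsTraceClass T₁) (h₂ : IsTraceClass T₂) : IsTraceClass (T₁ + T₂) := by
  obtain ⟨X, Y, hX, hY, hXY, hYX, hT, habs⟩ := exists_parts (s₁.add s₂)
  obtain ⟨X₁, Y₁, hX₁, hY₁, -, -, hT₁, habs₁⟩ := exists_parts s₁
  obtain ⟨X₂, Y₂, hX₂, hY₂, -, -, hT₂, habs₂⟩ := exists_parts s₂
  rw [isTraceClass_iff_parts hX₁ hY₁ habs₁] at h₁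
  rw [isTraceClass_iff_parts hX₂ hY₂ habs₂] at h₂
  rw [isTraceClass_iff_parts hX hY habs]
  have e : X - Y = (X₁ + X₂) - (Y₁ + Y₂) := by
    rw [hT, ← hT₁, ← hT₂]; abel
  have e' : Y - X = (Y₁ + Y₂) - (X₁ + X₂) := by
    rw [← neg_sub, e, neg_sub]
  constructor
  · refine ne_top_of_le_ne_top (ENNReal.add_ne_top.2 ⟨h₁.1, h₂.1⟩) ?_
    exact (etrace_le_of_sub_eq _ hX (add_nonneg hX₁ hX₂) (add_nonneg hY₁ hY₂) hYX e).trans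
      (etrace_add_le _ _ _)
  · refine ne_top_of_le_ne_top (ENNReal.add_ne_top.2 ⟨h₁.2, h₂.2⟩) ?_
    exact (etrace_le_of_sub_eq _ hY (add_nonneg hY₁ hY₂) (add_nonneg hX₁ hX₂) hXY e').trans
      (etrace_add_le _ _ _)

theorem IsTraceClass.smul {T : H →L[ℂ] H} (r : ℝ) (h : IsTraceClass T) :
    IsTraceClass (r • T) := by
  have habs : CFC.abs (r • T) = |r| • CFC.abs T := CFC.abs_smul r T
  have hs := Summable.mul_left |r| h
  have e : ∀ x : H, (inner ℂ x (CFC.abs (r • T) x)).re = |r| * (inner ℂ x (CFC.abs T x)).re := by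
    intro x
    rw [habs, _root_.smul_apply, ← Complex.coe_smul, inner_smul_right, Complex.re_ofReal_mul]
  unfold IsTraceClass
  simpa only [e] using hs

theorem isTraceClass_zero : IsTraceClass (0 : H →L[ℂ] H) := by
  simp [IsTraceClass]

variable (H)

/-- `𝒯_s(H)`: the real vector space of the self-adjoint trace-class operators. -/
def TraceClassSA : Submodule ℝ (H →L[ℂ] H) where
  carrier := {T | IsSelfAdjoint T ∧ IsTraceClass T}
  add_mem' h₁ h₂ := ⟨h₁.1.add h₂.1, h₁.2.add h₁.1 h₂.1 h₂.2⟩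
  zero_mem' := ⟨IsSelfAdjoint.zero _, isTraceClass_zero⟩
  smul_mem' r _ h := ⟨(IsSelfAdjoint.all r).smul h.1, h.2.smul r⟩

variable {H}

theorem hasSum_norm_sq {M : H →L[ℂ] H} (hM : ∑' i, ‖M (stdBasis H i)‖ₑ ^ 2 ≠ ⊤)
    {ι : Type*} (b : HilbertBasis ι ℂ H) :
    HasSum (fun i => ‖M (b i)‖ ^ 2) (∑' i, ‖M (stdBasis H i)‖ₑ ^ 2).toReal := by
  rw [tsum_enorm_sq_basis (stdBasis H) b] at hM ⊢
  have h := ENNReal.hasSum_toReal hM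
  rw [← ENNReal.tsum_toReal_eq (fun i => by simp)] at h
  simpa only [ENNReal.toReal_pow, toReal_enorm] using h

theorem tsum_enorm_sq_add_ne_top {M N : H →L[ℂ] H} {ι : Type*} (b : HilbertBasis ι ℂ H)
    (hM : ∑' i, ‖M (b i)‖ₑ ^ 2 ≠ ⊤) (hN : ∑' i, ‖N (b i)‖ₑ ^ 2 ≠ ⊤) (z : ℂ) :
    ∑' i, ‖(M + z • N) (b i)‖ₑ ^ 2 ≠ ⊤ := by
  have h : ∑' i, (2 * ‖M (b i)‖ₑ ^ 2 + 2 * ‖z‖ₑ ^ 2 * ‖N (b i)‖ₑ ^ 2) ≠ ⊤ := by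
    rw [ENNReal.tsum_add, ENNReal.tsum_mul_left, ENNReal.tsum_mul_left]
    refine ENNReal.add_ne_top.2 ⟨ENNReal.mul_ne_top (by simp) hM, ENNReal.mul_ne_top ?_ hN⟩
    exact ENNReal.mul_ne_top (by simp) (by simp)
  refine ne_top_of_le_ne_top h (ENNReal.tsum_le_tsum fun i => ?_)
  have h1 : ‖(M + z • N) (b i)‖ ^ 2 ≤ 2 * ‖M (b i)‖ ^ 2 + 2 * ‖z‖ ^ 2 * ‖N (b i)‖ ^ 2 := by
    have h2 : ‖(M + z • N) (b i)‖ ≤ ‖M (b i)‖ + ‖z‖ * ‖N (b i)‖ := by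
      rw [← norm_smul]; exact norm_add_le _ _
    nlinarith [norm_nonneg ((M + z • N) (b i)), sq_nonneg (‖M (b i)‖ - ‖z‖ * ‖N (b i)‖)]
  have h3 := ENNReal.ofReal_le_ofReal h1
  rw [ENNReal.ofReal_add (by positivity) (by positivity), ENNReal.ofReal_mul (by positivity),
    ENNReal.ofReal_mul (by positivity), ENNReal.ofReal_mul (by positivity)] at h3
  simpa [ENNReal.ofReal_pow, ofReal_norm] using h3

/-- For Hilbert-Schmidt `M`, `N` the sum `∑ ⟨M eᵢ, N eᵢ⟩` converges, and its value does not depend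
on the orthonormal basis. -/
theorem hasSum_inner_of_hilbertSchmidt {M N : H →L[ℂ] H}
    (hM : ∑' i, ‖M (stdBasis H i)‖ₑ ^ 2 ≠ ⊤) (hN : ∑' i, ‖N (stdBasis H i)‖ₑ ^ 2 ≠ ⊤)
    {ι : Type*} (b : HilbertBasis ι ℂ H) :
    HasSum (fun i => inner ℂ (M (b i)) (N (b i)))
      (∑' i, inner ℂ (M (stdBasis H i)) (N (stdBasis H i))) := by
  have key := fun z : ℂ => tsum_enorm_sq_add_ne_top (stdBasis H) hM hN z
  have h1 : ∀ z : ℂ, HasSum (fun i => ((‖M (b i) + z • N (b i)‖ ^ 2 : ℝ) : ℂ)) _ :=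
    fun z => (hasSum_norm_sq (key z) b).mapL Complex.ofRealCLM
  have h2 : ∀ z : ℂ, HasSum (fun i => ((‖M (stdBasis H i) + z • N (stdBasis H i)‖ ^ 2 : ℝ) : ℂ)) _ :=
    fun z => (hasSum_norm_sq (key z) (stdBasis H)).mapL Complex.ofRealCLM
  have e : ∀ x y : H, inner ℂ x y =
      (((‖x + (1 : ℂ) • y‖ ^ 2 : ℝ) : ℂ) - ((‖x + (-1 : ℂ) • y‖ ^ 2 : ℝ) : ℂ) +
        (((‖x + (-Complex.I) • y‖ ^ 2 : ℝ) : ℂ) - ((‖x + Complex.I • y‖ ^ 2 : ℝ) : ℂ)) *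
          Complex.I) / 4 := by
    intro x y
    rw [inner_eq_sum_norm_sq_div_four]
    simp [sub_eq_add_neg]
  have g1 := (((h1 1).sub (h1 (-1))).add
    (((h1 (-Complex.I)).sub (h1 Complex.I)).mul_right Complex.I)).div_const 4
  have g2 := (((h2 1).sub (h2 (-1))).add
    (((h2 (-Complex.I)).sub (h2 Complex.I)).mul_right Complex.I)).div_const 4
  simp only [← e] at g1 g2
  rwa [g2.tsum_eq]

theorem hasSum_trace_mul_of_nonneg {X A : H →L[ℂ] H} (hX : 0 ≤ X)
    (h : etrace (stdBasis H) X ≠ ⊤) {ι : Type*} (b : HilbertBasis ι ℂ H) :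
    HasSum (fun i => inner ℂ (b i) ((X * A) (b i))) (trace (X * A)) := by
  have hM : ∑' i, ‖CFC.sqrt X (stdBasis H i)‖ₑ ^ 2 ≠ ⊤ := by rwa [← etrace_eq _ hX]
  have hN : ∑' i, ‖(CFC.sqrt X * A) (stdBasis H i)‖ₑ ^ 2 ≠ ⊤ := by
    have hS2 : adjoint (CFC.sqrt X) = CFC.sqrt X :=
      (IsSelfAdjoint.of_nonneg (CFC.sqrt_nonneg X)).adjoint_eq
    rw [tsum_enorm_sq_adjoint _ (stdBasis H)]
    have ha : adjoint (CFC.sqrt X * A) = adjoint A * CFC.sqrt X := by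
      change adjoint (CFC.sqrt X ∘L A) = _
      rw [adjoint_comp, hS2]; rfl
    rw [ha]
    refine ne_top_of_le_ne_top (ENNReal.mul_ne_top (a := ‖adjoint A‖ₑ ^ 2) (by simp) hM) ?_
    rw [← ENNReal.tsum_mul_left]
    refine ENNReal.tsum_le_tsum fun i => ?_
    rw [← mul_pow]
    gcongr
    exact (adjoint A).le_opENorm _
  have e : ∀ x : H, inner ℂ x ((X * A) x) = inner ℂ (CFC.sqrt X x) ((CFC.sqrt X * A) x) :=
    fun x => inner_conj_sqrt hX x (A x)
  simpa only [trace, e] using hasSum_inner_of_hilbertSchmidt hM hN b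

/-- For self-adjoint trace-class `V` and bounded `A`, the series defining `tr (V A)` converges
(unconditionally) in every orthonormal basis, to the same value. -/
theorem hasSum_trace_mul {V : H →L[ℂ] H} (hV : V ∈ TraceClassSA H) (A : H →L[ℂ] H)
    {ι : Type*} (b : HilbertBasis ι ℂ H) :
    HasSum (fun i => inner ℂ (b i) ((V * A) (b i))) (trace (V * A)) := by
  obtain ⟨X, Y, hX, hY, -, -, hT, habs⟩ := exists_parts hV.1
  obtain ⟨h1, h2⟩ := (isTraceClass_iff_parts hX hY habs).1 hV.2
  have e : ∀ x : H, inner ℂ x ((V * A) x) = inner ℂ x ((X * A) x) - inner ℂ x ((Y * A) x) := by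
    intro x
    rw [← hT, sub_mul, sub_apply, inner_sub_right]
  have hb := (hasSum_trace_mul_of_nonneg (A := A) hX h1 b).sub
    (hasSum_trace_mul_of_nonneg (A := A) hY h2 b)
  have hs := (hasSum_trace_mul_of_nonneg (A := A) hX h1 (stdBasis H)).sub
    (hasSum_trace_mul_of_nonneg (A := A) hY h2 (stdBasis H))
  simp only [← e] at hb hs
  rwa [trace, hs.tsum_eq]

/-- The duality `⟨V, A⟩ = tr (V A)` between the self-adjoint trace-class operators and the bounded
self-adjoint operators. (The trace is a real number here, written as its real part.) -/
noncomputable def pairing (V : TraceClassSA H) (A : selfAdjoint (H →L[ℂ] H)) : ℝ :=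
  (trace ((V : H →L[ℂ] H) * (A : H →L[ℂ] H))).re

variable (H)

/-- `σ(𝒯_s(H), ℬ_s(H))`: the coarsest topology on `𝒯_s(H)` for which all the functionals
`V ↦ tr (V A)`, `A` bounded and self-adjoint, are continuous. -/
@[reducible]
noncomputable def quantumWeakTopology : TopologicalSpace (TraceClassSA H) :=
  ⨅ A : selfAdjoint (H →L[ℂ] H), TopologicalSpace.induced (fun V => pairing V A) inferInstance

/-- `𝒮(H)`: the density operators, i.e. the positive trace-class operators of trace `1`. -/
def densityOperators : Set (TraceClassSA H) :=
  {W | (W : H →L[ℂ] H).IsPositive ∧ trace (W : H →L[ℂ] H) = 1}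

/-- `𝒫(H)`: the pure states, i.e. the one-dimensional orthogonal projections `|φ⟩⟨φ|`,
`‖φ‖ = 1`. -/
def pureStates : Set (TraceClassSA H) :=
  {P | ∃ φ : H, ‖φ‖ = 1 ∧ (P : H →L[ℂ] H) = InnerProductSpace.rankOne ℂ φ φ}

end Quantum

section Classical

variable (Ω : Type*) [MeasurableSpace Ω]

/-- `ℱ(Ω, Σ)`: the bounded measurable real functions. -/
def boundedMeasurable : Set (Ω → ℝ) :=
  {f | Measurable f ∧ ∃ C : ℝ, ∀ ω, |f ω| ≤ C}

/-- `σ(ℳ(Ω, Σ), ℱ(Ω, Σ))`: the coarsest topology on the space of the real-valued measures for which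
all the functionals `ν ↦ ∫ f dν`, `f` bounded and measurable, are continuous. -/
@[reducible]
noncomputable def classicalWeakTopology : TopologicalSpace (SignedMeasure Ω) :=
  ⨅ f : boundedMeasurable Ω,
    TopologicalSpace.induced (fun ν => ∫ᵛ ω, (f : Ω → ℝ) ω ∂•ν) inferInstance

/-- `𝒮(Ω, Σ)`: the probability measures, as a set of real-valued measures. -/
def probabilityMeasures : Set (SignedMeasure Ω) :=
  {μ | (∀ E, MeasurableSet E → 0 ≤ μ E) ∧ μ Set.univ = 1}

variable {Ω}

/-- The Dirac measure at `ω`, as a real-valued measure. -/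
noncomputable def dirac (ω : Ω) : SignedMeasure Ω := VectorMeasure.dirac ω 1

/-- The real-valued measures vanishing on all measurable subsets of the complement of `S`. -/
def concentratedOn (S : Set Ω) : Submodule ℝ (SignedMeasure Ω) where
  carrier := {ν | ∀ E, MeasurableSet E → E ⊆ Sᶜ → ν E = 0}
  add_mem' h₁ h₂ E hE hES := by simp [h₁ E hE hES, h₂ E hE hES]
  zero_mem' E _ _ := by simp
  smul_mem' r ν h E hE hES := by simp [h E hE hES]

/-- The restriction of a real-valued measure to the measurable subsets of a measurable set `S`
(identified with the measurable sets of the measurable space `S`). -/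
def restrictTo (S : Set Ω) (hS : MeasurableSet S) (ν : SignedMeasure Ω) : SignedMeasure S where
  measureOf' E := ν (Subtype.val '' E)
  empty' := by simp
  not_measurable' E hE := by
    refine ν.not_measurable fun h => hE ?_
    rwa [← (MeasurableEmbedding.subtype_coe hS).measurableSet_image]
  m_iUnion' f hf hd := by
    rw [Set.image_iUnion]
    exact ν.m_iUnion (fun i => hS.subtype_image (hf i))
      fun i j hij => (Set.disjoint_image_iff Subtype.val_injective).2 (hd hij)

theorem restrictTo_apply (S : Set Ω) (hS : MeasurableSet S) (ν : SignedMeasure Ω) (E : Set S) :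
    restrictTo S hS ν E = ν (Subtype.val '' E) := rfl

/-- `J`: restriction is a linear isomorphism from the measures concentrated on `S` onto the measures
on `S`, with the inverse `ν ↦ (E ↦ ν (E ∩ S))`. -/
noncomputable def restrictEquiv (S : Set Ω) (hS : MeasurableSet S) :
    concentratedOn S ≃ₗ[ℝ] SignedMeasure S where
  toFun ν := restrictTo S hS ν
  map_add' ν₁ ν₂ := by ext E hE; simp [restrictTo_apply]
  map_smul' r ν := by ext E hE; simp [restrictTo_apply]
  invFun ν := ⟨ν.map Subtype.val, fun E hE hES => by
    rw [VectorMeasure.map_apply _ measurable_subtype_coe hE]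
    have : (Subtype.val : S → Ω) ⁻¹' E = ∅ := by
      ext x; simpa using fun h => hES h x.2
    rw [this, VectorMeasure.empty]⟩
  left_inv ν := by
    ext E hE
    change (restrictTo S hS ν).map Subtype.val E = (ν : SignedMeasure Ω) E
    rw [VectorMeasure.map_apply _ measurable_subtype_coe hE, restrictTo_apply,
      Subtype.image_preimage_coe]
    have h0 : (ν : SignedMeasure Ω) (E \ S) = 0 := ν.2 (E \ S) (hE.diff hS) fun x hx => hx.2
    have h1 := VectorMeasure.of_union (v := (ν : SignedMeasure Ω))
      (Set.disjoint_sdiff_right.mono_left Set.inter_subset_left : Disjoint (S ∩ E) (E \ S))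
      (hS.inter hE) (hE.diff hS)
    rw [h0, add_zero, Set.inter_comm, Set.inter_union_sdiff] at h1
    rw [Set.inter_comm, h1]
  right_inv ν := by
    ext E hE
    rw [restrictTo_apply, VectorMeasure.map_apply _ measurable_subtype_coe (hS.subtype_image hE),
      Set.preimage_image_eq _ Subtype.val_injective]

/-- The restriction of the Dirac measure at a point of `S` is the Dirac measure on `S`. -/
theorem restrictTo_dirac (S : Set Ω) (hS : MeasurableSet S) (ω : S) :
    restrictTo S hS (dirac (ω : Ω)) = dirac ω := by
  ext E hE
  rw [restrictTo_apply]
  by_cases h : ω ∈ E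
  · rw [dirac, dirac, VectorMeasure.dirac_apply_of_mem hE h,
      VectorMeasure.dirac_apply_of_mem (hS.subtype_image hE) ⟨ω, h, rfl⟩]
  · rw [dirac, dirac, VectorMeasure.dirac_apply_of_notMem h,
      VectorMeasure.dirac_apply_of_notMem]
    simpa using h

end Classical

section Reduction

variable {H : Type*} [NormedAddCommGroup H] [InnerProductSpace ℂ H] [CompleteSpace H]
  {Ω : Type*} [MeasurableSpace Ω]

/-- A linear map `R : ℳ(Ω, Σ) → 𝒯_s(H)` is a reduction map if it maps the probability measures onto
the density operators and is `σ(ℳ, ℱ)`-`σ(𝒯_s, ℬ_s)`-continuous. -/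
structure IsReductionMap (R : SignedMeasure Ω →ₗ[ℝ] TraceClassSA H) : Prop where
  image_eq : R '' probabilityMeasures Ω = densityOperators H
  continuous : Continuous[classicalWeakTopology Ω, quantumWeakTopology H] R

/-- `Ω̃ = {ω | R δ_ω is a pure state}`. -/
def pureSet (R : SignedMeasure Ω →ₗ[ℝ] TraceClassSA H) : Set Ω :=
  {ω | R (dirac ω) ∈ pureStates H}

/-- `R J⁻¹ : ℳ(S, Σ ∩ S) → 𝒯_s(H)`, where `J` restricts measures concentrated on `S` to `S`. -/
noncomputable def restrictedMap (R : SignedMeasure Ω →ₗ[ℝ] TraceClassSA H) {S : Set Ω}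
    (hS : MeasurableSet S) : SignedMeasure S →ₗ[ℝ] TraceClassSA H :=
  R ∘ₗ (concentratedOn S).subtype ∘ₗ (restrictEquiv S hS).symm.toLinearMap

end Reduction

end ClassicalExtension

open ClassicalExtension MeasureTheory TopologicalSpace

/-!
A self-adjoint trace-class operator `W` is determined by its expectation values
`⟨x, W x⟩ = tr (W |x⟩⟨x|)`, so the proof works with quadratic forms throughout. For a continuous
linear `R` the functional `ν ↦ ⟨x, (R ν) x⟩` is weakly continuous, hence lies in the span of the
functionals `ν ↦ ∫ f dν`, i.e. it is itself of this form; evaluation at `ν = δ_ω` identifies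
`f ω = ⟨x, (R δ_ω) x⟩` (`re_inner_eq_integral`). In particular the matrix entries of `R δ_ω` are
measurable in `ω`. A density operator is pure exactly when its `2 × 2` minors vanish
(`mem_pureStates_iff`), which by continuity needs to be tested on a countable dense set of vectors
only; so `pureSet R`, the set of the `ω` with `R δ_ω` pure, is measurable (`measurableSet_pureSet`).

Let `|φ⟩⟨φ| = R μ` with a probability measure `μ`. Then `∫ ⟨φ, (R δ_ω) φ⟩ dμ(ω) = 1`, where the
integrand is at most `1`; so it equals `1` for almost all `ω`, and this forces `R δ_ω = |φ⟩⟨φ|`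
(`exists_map_dirac_eq`). Hence the pure states are exactly the images of the Dirac measures at the
points of `pureSet R`. Finally, for an orthonormal basis `(eᵢ)`, a density operator `W` is the sum
`∑ |vᵢ⟩⟨vᵢ|` with `vᵢ = √W eᵢ` and `∑ ‖vᵢ‖² = 1`, by Parseval's identity and without the spectral
theorem (`exists_decomposition`). So `W` is the image of the probability measure `∑ ‖vᵢ‖² δ_{ωᵢ}` on
`pureSet R`, where `R δ_{ωᵢ}` is the pure state of direction `vᵢ` (`densityOperators_subset_image`).
-/

namespace ClassicalExtension

open scoped Topology

/-! ### Integration against real-valued measures -/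

section Integral

variable {Ω : Type*} [MeasurableSpace Ω]

instance isFiniteMeasure_variation (ν : SignedMeasure Ω) : IsFiniteMeasure ν.variation := by
  rw [← SignedMeasure.totalVariation_eq_variation]; infer_instance

theorem integrable_of_mem_boundedMeasurable {f : Ω → ℝ} (hf : f ∈ boundedMeasurable Ω)
    (μ : Measure Ω) [IsFiniteMeasure μ] : Integrable f μ := by
  obtain ⟨hm, C, hC⟩ := hf
  exact .of_bound hm.aestronglyMeasurable C (.of_forall hC)

/-- The functional `ν ↦ ∫ f dν` given by a bounded measurable function `f`. -/
noncomputable def integralFunctional (f : boundedMeasurable Ω) : SignedMeasure Ω →ₗ[ℝ] ℝ where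
  toFun ν := ∫ᵛ ω, (f : Ω → ℝ) ω ∂•ν
  map_add' _ _ := VectorMeasure.integral_add_vectorMeasure
    (integrable_of_mem_boundedMeasurable f.2 _) (integrable_of_mem_boundedMeasurable f.2 _)
  map_smul' r _ := VectorMeasure.integral_smul_vectorMeasure _ r

theorem integral_dirac_of_measurable {f : Ω → ℝ} (hf : Measurable f) (ω : Ω) :
    ∫ᵛ x, f x ∂•(dirac ω) = f ω := by
  rw [dirac, VectorMeasure.integral_dirac' hf.stronglyMeasurable]
  simp

theorem integral_toSignedMeasure (μ : Measure Ω) [IsFiniteMeasure μ] (f : Ω → ℝ) :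
    ∫ᵛ x, f x ∂•μ.toSignedMeasure = ∫ x, f x ∂μ := by
  rw [← VectorMeasure.integral_toSignedMeasure]
  congr 1
  ext; simp

/-- A nonnegative real-valued measure of total mass `1` comes from a probability measure with values
in `[0, ∞]`. -/
theorem exists_eq_toSignedMeasure {ν : SignedMeasure Ω} (hν : ν ∈ probabilityMeasures Ω) :
    ∃ μ : Measure Ω, ∃ _ : IsProbabilityMeasure μ, μ.toSignedMeasure = ν := by
  have h0 : VectorMeasure.restrict 0 Set.univ ≤ ν.restrict Set.univ := by
    rw [VectorMeasure.le_restrict_univ_iff_le]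
    intro E hE
    simpa using hν.1 E hE
  have h1 := ν.toMeasureOfZeroLE_toSignedMeasure h0
  refine ⟨ν.toMeasureOfZeroLE Set.univ .univ h0, ⟨?_⟩, h1⟩
  have h3 : (ν.toMeasureOfZeroLE Set.univ .univ h0).real Set.univ = 1 := by
    rw [SignedMeasure.toMeasureOfZeroLE_real_apply _ h0 .univ .univ, Set.univ_inter]
    exact hν.2
  rwa [measureReal_def, ENNReal.toReal_eq_one_iff] at h3

theorem toSignedMeasure_mem_probabilityMeasures (μ : Measure Ω) [IsProbabilityMeasure μ] :
    μ.toSignedMeasure ∈ probabilityMeasures Ω := by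
  refine ⟨fun E hE => ?_, ?_⟩
  · rw [Measure.toSignedMeasure_apply_measurable hE]; exact measureReal_nonneg
  · rw [Measure.toSignedMeasure_apply_measurable .univ]; simp

theorem dirac_mem_probabilityMeasures (ω : Ω) : dirac ω ∈ probabilityMeasures Ω := by
  refine ⟨fun E hE => ?_, VectorMeasure.dirac_apply_of_mem .univ (Set.mem_univ ω)⟩
  by_cases h : ω ∈ E
  · rw [dirac, VectorMeasure.dirac_apply_of_mem hE h]; exact zero_le_one
  · rw [dirac, VectorMeasure.dirac_apply_of_notMem h]

/-- Every weakly continuous linear functional is integration against a bounded measurable function,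
as it lies in the span of the functionals defining the topology. -/
theorem exists_eq_integral_of_continuous (φ : SignedMeasure Ω →ₗ[ℝ] ℝ)
    (hφ : Continuous[classicalWeakTopology Ω, inferInstance] φ) :
    ∃ f ∈ boundedMeasurable Ω, ∀ ν, φ ν = ∫ᵛ ω, f ω ∂•ν := by
  have h := (LinearMap.mem_span_iff_continuous (f := integralFunctional (Ω := Ω)) φ).2 hφ
  clear hφ
  induction h using Submodule.span_induction with
  | mem x hx =>
    obtain ⟨f, rfl⟩ := hx
    exact ⟨f, f.2, fun ν => rfl⟩
  | zero => exact ⟨0, ⟨measurable_const, 0, by simp⟩, fun ν => VectorMeasure.integral_zero.symm⟩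
  | add x y _ _ hx hy =>
    obtain ⟨f, hf, hfx⟩ := hx
    obtain ⟨g, hg, hgy⟩ := hy
    obtain ⟨C, hC⟩ := hf.2
    obtain ⟨D, hD⟩ := hg.2
    refine ⟨fun ω => f ω + g ω, ⟨hf.1.add hg.1, C + D, fun ω =>
      (abs_add_le _ _).trans (add_le_add (hC ω) (hD ω))⟩, fun ν => ?_⟩
    rw [LinearMap.add_apply, hfx, hgy, VectorMeasure.integral_fun_add
      (integrable_of_mem_boundedMeasurable hf _) (integrable_of_mem_boundedMeasurable hg _)]
  | smul a x _ hx =>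
    obtain ⟨f, hf, hfx⟩ := hx
    obtain ⟨C, hC⟩ := hf.2
    refine ⟨fun ω => a • f ω, ⟨hf.1.const_smul a, |a| * C, fun ω => ?_⟩, fun ν => ?_⟩
    · change |a * f ω| ≤ _
      rw [abs_mul]
      exact mul_le_mul_of_nonneg_left (hC ω) (abs_nonneg a)
    · rw [LinearMap.smul_apply, hfx, VectorMeasure.integral_fun_smul]

end Integral

/-! ### Density operators and their quadratic forms -/

section Operators

variable {H : Type*} [NormedAddCommGroup H] [InnerProductSpace ℂ H]

theorem hasSum_norm_inner_sq {ι : Type*} (b : HilbertBasis ι ℂ H) (x : H) :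
    HasSum (fun i => ‖inner ℂ (b i) x‖ ^ 2) (‖x‖ ^ 2) := by
  have h := (b.hasSum_inner_mul_inner x x).mapL Complex.reCLM
  convert h using 1
  · funext i
    rw [← inner_conj_symm x (b i)]
    simp only [Complex.reCLM_apply]
    rw [mul_comm, Complex.mul_conj, Complex.normSq_eq_norm_sq, Complex.ofReal_re]
  · simp [inner_self_eq_norm_sq_to_K, ← Complex.ofReal_pow]

theorem inner_rankOne_self (x y : H) :
    inner ℂ y (InnerProductSpace.rankOne ℂ x x y) = ((‖inner ℂ x y‖ ^ 2 : ℝ) : ℂ) := by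
  rw [InnerProductSpace.rankOne_apply, inner_smul_right, ← inner_conj_symm y x, Complex.mul_conj,
    Complex.normSq_eq_norm_sq]

variable [CompleteSpace H]

/-- `|x⟩⟨x|` as a bounded self-adjoint operator. -/
noncomputable def rankOneSA (x : H) : selfAdjoint (H →L[ℂ] H) :=
  ⟨InnerProductSpace.rankOne ℂ x x, (InnerProductSpace.isPositive_rankOne_self x).isSelfAdjoint⟩

/-- Expectation values of rank-one operators are values of the quadratic form of `V`. -/
theorem pairing_rankOneSA (V : TraceClassSA H) (x : H) :
    pairing V (rankOneSA x) = (inner ℂ x ((V : H →L[ℂ] H) x)).re := by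
  have e : ∀ i, inner ℂ (stdBasis H i) (((V : H →L[ℂ] H) * InnerProductSpace.rankOne ℂ x x)
      (stdBasis H i)) = inner ℂ x (stdBasis H i) *
        inner ℂ (stdBasis H i) ((V : H →L[ℂ] H) x) := fun i => by
    rw [mul_apply_eq_comp, InnerProductSpace.rankOne_apply, map_smul, inner_smul_right]
  rw [pairing, rankOneSA, trace, tsum_congr e, HilbertBasis.tsum_inner_mul_inner]

theorem trace_rankOne_self (x : H) :
    trace (InnerProductSpace.rankOne ℂ x x) = ((‖x‖ ^ 2 : ℝ) : ℂ) := by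
  have e : ∀ i, inner ℂ (stdBasis H i) (InnerProductSpace.rankOne ℂ x x (stdBasis H i)) =
      inner ℂ x (stdBasis H i) * inner ℂ (stdBasis H i) x := fun i => by
    rw [InnerProductSpace.rankOne_apply, inner_smul_right]
  rw [trace, tsum_congr e, HilbertBasis.tsum_inner_mul_inner, inner_self_eq_norm_sq_to_K]
  simp

theorem rankOne_mem_traceClassSA (x : H) :
    InnerProductSpace.rankOne ℂ x x ∈ TraceClassSA H := by
  refine ⟨(rankOneSA x).2, ?_⟩
  rw [IsTraceClass, CFC.abs_of_nonneg _ ((ContinuousLinearMap.nonneg_iff_isPositive _).2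
    (InnerProductSpace.isPositive_rankOne_self x))]
  simp only [inner_rankOne_self, Complex.ofReal_re]
  simpa only [norm_inner_symm] using (hasSum_norm_inner_sq (stdBasis H) x).summable

theorem inner_eq_re (V : TraceClassSA H) (x : H) :
    inner ℂ x ((V : H →L[ℂ] H) x) = ((inner ℂ x ((V : H →L[ℂ] H) x)).re : ℂ) :=
  (V.2.1.isSymmetric.coe_re_inner_self_apply x).symm

/-- Self-adjoint operators are determined by their quadratic forms. -/
theorem eq_of_re_inner_eq {A B : H →L[ℂ] H} (hA : IsSelfAdjoint A) (hB : IsSelfAdjoint B)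
    (h : ∀ x, (inner ℂ x (A x)).re = (inner ℂ x (B x)).re) : A = B := by
  refine ContinuousLinearMap.coe_injective ((ext_inner_map _ _).1 fun x => ?_)
  have h1 := hA.isSymmetric.coe_re_inner_apply_self x
  have h2 := hB.isSymmetric.coe_re_inner_apply_self x
  rw [← h1, ← h2, hA.isSymmetric x x, hB.isSymmetric x x]
  exact congrArg _ (h x)

theorem eq_rankOne {V : TraceClassSA H} {φ : H}
    (h : ∀ x, (inner ℂ x ((V : H →L[ℂ] H) x)).re = ‖inner ℂ φ x‖ ^ 2) :
    (V : H →L[ℂ] H) = InnerProductSpace.rankOne ℂ φ φ :=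
  eq_of_re_inner_eq V.2.1 (rankOneSA φ).2 fun x => by
    rw [h, inner_rankOne_self, Complex.ofReal_re]

theorem pureStates_subset_densityOperators : pureStates H ⊆ densityOperators H := by
  rintro P ⟨φ, hφ, hP⟩
  rw [densityOperators, Set.mem_ofPred_eq, hP]
  exact ⟨InnerProductSpace.isPositive_rankOne_self φ, by rw [trace_rankOne_self, hφ]; simp⟩

/-- A density operator is a `σ`-convex combination `∑ |vᵢ⟩⟨vᵢ|` of multiples of pure states. With
`vᵢ = √W eᵢ` this is Parseval's identity. -/
theorem exists_decomposition {W : TraceClassSA H} (hW : W ∈ densityOperators H) :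
    ∃ v : stdIndex H → H, HasSum (fun i => ‖v i‖ ^ 2) 1 ∧
      ∀ x, HasSum (fun i => ‖inner ℂ (v i) x‖ ^ 2) (inner ℂ x ((W : H →L[ℂ] H) x)).re := by
  have h0 : 0 ≤ (W : H →L[ℂ] H) := (ContinuousLinearMap.nonneg_iff_isPositive _).2 hW.1
  have hS : ∀ x : H, (inner ℂ x ((W : H →L[ℂ] H) x)).re =
      ‖CFC.sqrt (W : H →L[ℂ] H) x‖ ^ 2 := fun x => by
    rw [inner_conj_sqrt h0]
    exact inner_self_eq_norm_sq (𝕜 := ℂ) _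
  have hsym : ∀ x y : H, inner ℂ (CFC.sqrt (W : H →L[ℂ] H) x) y =
      inner ℂ x (CFC.sqrt (W : H →L[ℂ] H) y) :=
    (IsSelfAdjoint.of_nonneg (CFC.sqrt_nonneg (W : H →L[ℂ] H))).isSymmetric
  refine ⟨fun i => CFC.sqrt (W : H →L[ℂ] H) (stdBasis H i), ?_, fun x => ?_⟩
  · -- The series defining `tr W` converges, as its sum is not the default value `0`.
    have h1 : Summable fun i => inner ℂ (stdBasis H i) ((W : H →L[ℂ] H) (stdBasis H i)) := by
      by_contra h
      have h2 := hW.2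
      rw [trace, tsum_eq_zero_of_not_summable h] at h2
      exact zero_ne_one h2
    have h2 := h1.hasSum.mapL Complex.reCLM
    have h3 : ∑' i, inner ℂ (stdBasis H i) ((W : H →L[ℂ] H) (stdBasis H i)) = 1 := hW.2
    simpa only [h3, Complex.reCLM_apply, hS, Complex.one_re] using h2
  · rw [hS]
    simpa only [hsym] using hasSum_norm_inner_sq (stdBasis H) (CFC.sqrt (W : H →L[ℂ] H) x)

theorem re_inner_le_one {W : TraceClassSA H} (hW : W ∈ densityOperators H) {φ : H}
    (hφ : ‖φ‖ = 1) : (inner ℂ φ ((W : H →L[ℂ] H) φ)).re ≤ 1 := by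
  obtain ⟨v, h1, h2⟩ := exists_decomposition hW
  refine hasSum_le (fun i => ?_) (h2 φ) h1
  gcongr
  simpa [hφ] using norm_inner_le_norm (𝕜 := ℂ) (v i) φ

/-- The only density operator with expectation `1` of `|φ⟩⟨φ|` is `|φ⟩⟨φ|`: this is the equality
case of the Cauchy-Schwarz inequality in every term of the decomposition. -/
theorem eq_rankOne_of_re_inner_eq_one {W : TraceClassSA H} (hW : W ∈ densityOperators H) {φ : H}
    (hφ : ‖φ‖ = 1) (h : (inner ℂ φ ((W : H →L[ℂ] H) φ)).re = 1) :
    (W : H →L[ℂ] H) = InnerProductSpace.rankOne ℂ φ φ := by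
  obtain ⟨v, h1, h2⟩ := exists_decomposition hW
  have hle : ∀ i, ‖inner ℂ (v i) φ‖ ^ 2 ≤ ‖v i‖ ^ 2 := fun i => by
    gcongr
    simpa [hφ] using norm_inner_le_norm (𝕜 := ℂ) (v i) φ
  have hs : HasSum (fun i => ‖v i‖ ^ 2 - ‖inner ℂ (v i) φ‖ ^ 2) 0 := by
    have := h1.sub (h2 φ)
    rwa [h, sub_self] at this
  have heq : ∀ i, ‖inner ℂ (v i) φ‖ = ‖v i‖ := fun i => by
    have := congrFun ((hasSum_zero_iff_of_nonneg fun i => sub_nonneg.2 (hle i)).1 hs) i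
    have h3 : ‖v i‖ ^ 2 = ‖inner ℂ (v i) φ‖ ^ 2 := sub_eq_zero.1 this
    exact ((sq_eq_sq₀ (norm_nonneg _) (norm_nonneg _)).1 h3).symm
  have hmul : ∀ i, ∃ r : ℂ, v i = r • φ := fun i => by
    rcases eq_or_ne (v i) 0 with h0 | h0
    · exact ⟨0, by rw [h0, zero_smul]⟩
    · have hφ0 : φ ≠ 0 := fun h => by simp [h] at hφ
      obtain ⟨r, -, hr⟩ := (norm_inner_eq_norm_iff (𝕜 := ℂ) hφ0 h0).1 (by
        rw [norm_inner_symm, heq, hφ, one_mul])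
      exact ⟨r, hr⟩
  refine eq_rankOne fun x => (h2 x).unique ?_
  have h3 := h1.mul_right (‖inner ℂ φ x‖ ^ 2)
  rw [one_mul] at h3
  suffices e : (fun i => ‖inner ℂ (v i) x‖ ^ 2) = fun i => ‖v i‖ ^ 2 * ‖inner ℂ φ x‖ ^ 2 by
    rwa [e]
  funext i
  obtain ⟨r, hr⟩ := hmul i
  rw [hr, inner_smul_left, norm_mul, norm_smul, hφ, mul_one, mul_pow, RCLike.norm_conj]

/-- A density operator is pure if and only if it has rank one, i.e. if its `2 × 2` minors vanish. -/
theorem mem_pureStates_iff {W : TraceClassSA H} (hW : W ∈ densityOperators H) :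
    W ∈ pureStates H ↔ ∀ x y : H,
      inner ℂ x ((W : H →L[ℂ] H) x) * inner ℂ y ((W : H →L[ℂ] H) y) =
        inner ℂ x ((W : H →L[ℂ] H) y) * inner ℂ y ((W : H →L[ℂ] H) x) := by
  constructor
  · rintro ⟨φ, -, hP⟩ x y
    simp only [hP, InnerProductSpace.rankOne_apply, inner_smul_right]
    ring
  · intro h
    obtain ⟨z, hz⟩ : ∃ z : H, (inner ℂ z ((W : H →L[ℂ] H) z)).re ≠ 0 := by
      by_contra! h0
      have h1 : (W : H →L[ℂ] H) = 0 := eq_of_re_inner_eq W.2.1 (.zero _) fun x => by simp [h0]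
      have h2 := hW.2
      rw [h1, trace] at h2
      simp at h2
    set c := (inner ℂ z ((W : H →L[ℂ] H) z)).re with hc
    have hc0 : 0 < c := lt_of_le_of_ne (hW.1.re_inner_nonneg_right z) hz.symm
    -- If `W = |φ⟩⟨φ|`, then `W z = ⟨φ, z⟩ φ` and `⟨z, W z⟩ = |⟨φ, z⟩|²`, so up to a phase `φ` is:
    set φ : H := ((Real.sqrt c)⁻¹ : ℂ) • (W : H →L[ℂ] H) z with hφdef
    have hφ : (W : H →L[ℂ] H) = InnerProductSpace.rankOne ℂ φ φ := by
      refine eq_rankOne fun x => ?_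
      have h1 := h x z
      rw [inner_eq_re W x, inner_eq_re W z, ← hc] at h1
      have h2 : inner ℂ z ((W : H →L[ℂ] H) x) = inner ℂ ((W : H →L[ℂ] H) z) x :=
        (W.2.1.isSymmetric z x).symm
      rw [h2, ← inner_conj_symm x ((W : H →L[ℂ] H) z), mul_comm (starRingEnd ℂ _), Complex.mul_conj,
        Complex.normSq_eq_norm_sq] at h1
      norm_cast at h1
      rw [hφdef, inner_smul_left, norm_mul, mul_pow, ← h1, RCLike.norm_conj, norm_inv,
        Complex.norm_real, inv_pow, Real.norm_eq_abs, sq_abs, Real.sq_sqrt hc0.le]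
      field_simp
    refine ⟨φ, ?_, hφ⟩
    have h2 := hW.2
    rw [hφ, trace_rankOne_self] at h2
    norm_cast at h2
    exact (pow_eq_one_iff_of_nonneg (norm_nonneg φ) two_ne_zero).1 h2

end Operators

/-! ### Reduction maps -/

section Reduction

variable {H : Type*} [NormedAddCommGroup H] [InnerProductSpace ℂ H] [CompleteSpace H]
  {Ω : Type*} [MeasurableSpace Ω]

/-- The quadratic form of `R ν` is obtained by integrating that of `R δ_ω`. -/
theorem re_inner_eq_integral {R : SignedMeasure Ω →ₗ[ℝ] TraceClassSA H}
    (hR : Continuous[classicalWeakTopology Ω, quantumWeakTopology H] R) (x : H) :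
    (fun ω => (inner ℂ x ((R (dirac ω) : H →L[ℂ] H) x)).re) ∈ boundedMeasurable Ω ∧
      ∀ ν, (inner ℂ x ((R ν : H →L[ℂ] H) x)).re =
        ∫ᵛ ω, (inner ℂ x ((R (dirac ω) : H →L[ℂ] H) x)).re ∂•ν := by
  let φ : SignedMeasure Ω →ₗ[ℝ] ℝ :=
    { toFun := fun ν => (inner ℂ x ((R ν : H →L[ℂ] H) x)).re
      map_add' := fun ν₁ ν₂ => by
        rw [map_add, Submodule.coe_add, _root_.add_apply, inner_add_right,
          Complex.add_re]
      map_smul' := fun r ν => by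
        rw [map_smul, Submodule.coe_smul, _root_.smul_apply, ← Complex.coe_smul,
          inner_smul_right, Complex.re_ofReal_mul, RingHom.id_apply, smul_eq_mul] }
  have hφ : Continuous[classicalWeakTopology Ω, inferInstance] φ := by
    have h1 : Continuous[quantumWeakTopology H, inferInstance]
        fun V : TraceClassSA H => pairing V (rankOneSA x) :=
      continuous_iInf_dom (i := rankOneSA x) continuous_induced_dom
    have h2 : (φ : SignedMeasure Ω → ℝ) = (fun V => pairing V (rankOneSA x)) ∘ R :=
      funext fun ν => (pairing_rankOneSA (R ν) x).symm
    rw [h2]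
    exact @Continuous.comp _ _ _ (classicalWeakTopology Ω) (quantumWeakTopology H) _ _ _ h1 hR
  obtain ⟨f, hf, hfφ⟩ := exists_eq_integral_of_continuous φ hφ
  have hfg : f = fun ω => (inner ℂ x ((R (dirac ω) : H →L[ℂ] H) x)).re := funext fun ω => by
    rw [← integral_dirac_of_measurable hf.1 ω, ← hfφ]; rfl
  subst hfg
  exact ⟨hf, hfφ⟩

/-- The matrix entries of `R δ_ω` depend measurably on `ω`. -/
theorem measurable_inner {R : SignedMeasure Ω →ₗ[ℝ] TraceClassSA H}
    (hR : Continuous[classicalWeakTopology Ω, quantumWeakTopology H] R) (x y : H) :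
    Measurable fun ω => inner ℂ x ((R (dirac ω) : H →L[ℂ] H) y) := by
  have hq : ∀ z : H, Measurable fun ω => inner ℂ ((R (dirac ω) : H →L[ℂ] H) z) z := fun z => by
    have h : ∀ ω, inner ℂ ((R (dirac ω) : H →L[ℂ] H) z) z =
        ((inner ℂ z ((R (dirac ω) : H →L[ℂ] H) z)).re : ℂ) := fun ω => by
      rw [← inner_eq_re]
      exact (R (dirac ω)).2.1.isSymmetric z z
    simp only [h]
    exact Complex.measurable_ofReal.comp (re_inner_eq_integral hR z).1.1
  have h : ∀ ω, inner ℂ x ((R (dirac ω) : H →L[ℂ] H) y) =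
      inner ℂ ((R (dirac ω) : H →L[ℂ] H) x) y :=
    fun ω => ((R (dirac ω)).2.1.isSymmetric x y).symm
  have hp := fun ω => inner_map_polarization' ((R (dirac ω) : H →L[ℂ] H) : H →ₗ[ℂ] H) x y
  simp only [ContinuousLinearMap.coe_coe] at hp
  simp only [h, hp]
  exact ((((hq _).sub (hq _)).sub ((hq _).const_mul _)).add ((hq _).const_mul _)).div_const _

theorem map_dirac_mem_densityOperators {R : SignedMeasure Ω →ₗ[ℝ] TraceClassSA H}
    (hR : IsReductionMap R) (ω : Ω) : R (dirac ω) ∈ densityOperators H :=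
  hR.image_eq ▸ Set.mem_image_of_mem R (dirac_mem_probabilityMeasures ω)

theorem measurableSet_pureSet [SeparableSpace H] {R : SignedMeasure Ω →ₗ[ℝ] TraceClassSA H}
    (hR : IsReductionMap R) : MeasurableSet (pureSet R) := by
  have h : pureSet R = ⋂ m : ℕ, ⋂ n : ℕ, {ω |
      inner ℂ (denseSeq H m) ((R (dirac ω) : H →L[ℂ] H) (denseSeq H m)) *
        inner ℂ (denseSeq H n) ((R (dirac ω) : H →L[ℂ] H) (denseSeq H n)) =
      inner ℂ (denseSeq H m) ((R (dirac ω) : H →L[ℂ] H) (denseSeq H n)) *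
        inner ℂ (denseSeq H n) ((R (dirac ω) : H →L[ℂ] H) (denseSeq H m))} := by
    ext ω
    simp only [Set.mem_iInter, Set.mem_ofPred_eq]
    rw [pureSet, Set.mem_ofPred_eq, mem_pureStates_iff (map_dirac_mem_densityOperators hR ω)]
    refine ⟨fun h m n => h _ _, fun h x y => ?_⟩
    refine (denseRange_denseSeq H).induction_on₂ (isClosed_eq ?_ ?_) h x y <;> fun_prop
  rw [h]
  refine .iInter fun m => .iInter fun n => measurableSet_eq_fun ?_ ?_ <;>
  exact (measurable_inner hR.continuous _ _).mul (measurable_inner hR.continuous _ _)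

/-- Every pure state is the image of a Dirac measure: if `P = |φ⟩⟨φ|` is the image of a probability
measure `μ`, then the integral of `⟨φ, R δ_ω φ⟩ ≤ 1` with respect to `μ` is `1`, so that
`⟨φ, R δ_ω φ⟩ = 1`, i.e. `R δ_ω = P`, for `μ`-almost all `ω`. -/
theorem exists_map_dirac_eq {R : SignedMeasure Ω →ₗ[ℝ] TraceClassSA H}
    (hR : IsReductionMap R) {P : TraceClassSA H} (hP : P ∈ pureStates H) :
    ∃ ω, R (dirac ω) = P := by
  obtain ⟨ν, hν, hνP⟩ : P ∈ R '' probabilityMeasures Ω :=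
    hR.image_eq ▸ pureStates_subset_densityOperators hP
  obtain ⟨μ, hμ, rfl⟩ := exists_eq_toSignedMeasure hν
  obtain ⟨φ, hφ, hPφ⟩ := hP
  obtain ⟨hb, hint⟩ := re_inner_eq_integral hR.continuous φ
  have h1 : ∫ ω, (inner ℂ φ ((R (dirac ω) : H →L[ℂ] H) φ)).re ∂μ = 1 := by
    rw [← integral_toSignedMeasure, ← hint, hνP, hPφ, inner_rankOne_self, Complex.ofReal_re,
      inner_self_eq_norm_sq_to_K, hφ]
    simp
  have hi := integrable_of_mem_boundedMeasurable hb μ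
  have h2 : ∫ ω, (1 - (inner ℂ φ ((R (dirac ω) : H →L[ℂ] H) φ)).re) ∂μ = 0 := by
    rw [integral_sub (integrable_const _) hi, h1]
    simp
  rw [integral_eq_zero_iff_of_nonneg (fun ω => sub_nonneg.2
    (re_inner_le_one (map_dirac_mem_densityOperators hR ω) hφ)) ((integrable_const _).sub hi)] at h2
  obtain ⟨ω, hω⟩ := h2.exists
  refine ⟨ω, Subtype.ext ?_⟩
  rw [hPφ]
  exact eq_rankOne_of_re_inner_eq_one (map_dirac_mem_densityOperators hR ω) hφ
    (sub_eq_zero.1 hω).symm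

/-- If the images of the Dirac measures exhaust the pure states, then every density operator
`∑ |vᵢ⟩⟨vᵢ|` is the image of a probability measure `∑ ‖vᵢ‖² δ_{ωᵢ}`. -/
theorem densityOperators_subset_image [Nontrivial H] {R : SignedMeasure Ω →ₗ[ℝ] TraceClassSA H}
    (hR : Continuous[classicalWeakTopology Ω, quantumWeakTopology H] R)
    (hp : ∀ P ∈ pureStates H, ∃ ω, R (dirac ω) = P) :
    densityOperators H ⊆ R '' probabilityMeasures Ω := by
  intro W hW
  have hp' : ∀ φ : H, ‖φ‖ = 1 → ∃ ω, ∀ x,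
      (inner ℂ x ((R (dirac ω) : H →L[ℂ] H) x)).re = ‖inner ℂ φ x‖ ^ 2 := fun φ hφ => by
    obtain ⟨ω, hω⟩ := hp ⟨_, rankOne_mem_traceClassSA φ⟩ ⟨φ, hφ, rfl⟩
    exact ⟨ω, fun x => by rw [hω, inner_rankOne_self, Complex.ofReal_re]⟩
  have hv : ∀ v : H, ∃ ω, ∀ x,
      ‖v‖ ^ 2 * (inner ℂ x ((R (dirac ω) : H →L[ℂ] H) x)).re = ‖inner ℂ v x‖ ^ 2 := fun v => by
    rcases eq_or_ne v 0 with rfl | hv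
    · obtain ⟨φ, hφ⟩ := exists_norm_eq H zero_le_one
      obtain ⟨ω, -⟩ := hp' φ hφ
      exact ⟨ω, fun x => by simp⟩
    · have hv' : ‖v‖ ≠ 0 := norm_ne_zero_iff.2 hv
      obtain ⟨ω, hω⟩ := hp' (((‖v‖⁻¹ : ℝ) : ℂ) • v) (by
        rw [norm_smul, Complex.norm_real, norm_inv, norm_norm, inv_mul_cancel₀ hv'])
      refine ⟨ω, fun x => ?_⟩
      rw [hω, inner_smul_left, norm_mul, RCLike.norm_conj, Complex.norm_real, norm_inv, norm_norm]
      field_simp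
  obtain ⟨v, h1, h2⟩ := exists_decomposition hW
  choose p hp using fun i => hv (v i)
  let μ : Measure Ω := Measure.sum fun i => ENNReal.ofReal (‖v i‖ ^ 2) • Measure.dirac (p i)
  have hμ : IsProbabilityMeasure μ := ⟨by
    rw [Measure.sum_apply _ .univ]
    simp only [Measure.smul_apply, measure_univ, smul_eq_mul, mul_one]
    rw [← ENNReal.ofReal_tsum_of_nonneg (fun i => sq_nonneg _) h1.summable, h1.tsum_eq,
      ENNReal.ofReal_one]⟩
  refine ⟨μ.toSignedMeasure, toSignedMeasure_mem_probabilityMeasures μ, Subtype.ext ?_⟩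
  refine eq_of_re_inner_eq (R _).2.1 W.2.1 fun x => ?_
  obtain ⟨hb, hint⟩ := re_inner_eq_integral hR x
  rw [hint, integral_toSignedMeasure]
  have h3 := hasSum_integral_measure (μ := fun i => ENNReal.ofReal (‖v i‖ ^ 2) •
    Measure.dirac (p i)) (integrable_of_mem_boundedMeasurable hb μ)
  refine h3.unique ?_
  suffices e : (fun i => ∫ ω, (inner ℂ x ((R (dirac ω) : H →L[ℂ] H) x)).re
      ∂ENNReal.ofReal (‖v i‖ ^ 2) • Measure.dirac (p i)) = fun i => ‖inner ℂ (v i) x‖ ^ 2 by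
    rw [e]
    exact h2 x
  funext i
  rw [integral_smul_measure, integral_dirac' _ _ hb.1.stronglyMeasurable,
    ENNReal.toReal_ofReal (sq_nonneg _), smul_eq_mul, hp]

theorem restrictedMap_apply (R : SignedMeasure Ω →ₗ[ℝ] TraceClassSA H) {S : Set Ω}
    (hS : MeasurableSet S) (ν : SignedMeasure S) :
    restrictedMap R hS ν = R (ν.map Subtype.val) := rfl

theorem restrictedMap_dirac (R : SignedMeasure Ω →ₗ[ℝ] TraceClassSA H) {S : Set Ω}
    (hS : MeasurableSet S) (ω : S) : restrictedMap R hS (dirac ω) = R (dirac (ω : Ω)) := by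
  rw [restrictedMap_apply]
  congr 1
  ext E hE
  rw [VectorMeasure.map_apply _ measurable_subtype_coe hE]
  by_cases h : (ω : Ω) ∈ E
  · rw [dirac, dirac, VectorMeasure.dirac_apply_of_mem hE h,
      VectorMeasure.dirac_apply_of_mem (measurable_subtype_coe hE) h]
  · rw [dirac, dirac, VectorMeasure.dirac_apply_of_notMem (by simpa using h),
      VectorMeasure.dirac_apply_of_notMem h]

theorem continuous_restrictedMap {R : SignedMeasure Ω →ₗ[ℝ] TraceClassSA H}
    (hR : Continuous[classicalWeakTopology Ω, quantumWeakTopology H] R) {S : Set Ω}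
    (hS : MeasurableSet S) :
    Continuous[classicalWeakTopology S, quantumWeakTopology H] (restrictedMap R hS) := by
  have h : Continuous[classicalWeakTopology S, classicalWeakTopology Ω]
      fun ν : SignedMeasure S => ν.map Subtype.val := by
    refine continuous_iInf_rng.2 fun f => continuous_induced_rng.2 ?_
    have hf : (fun x : S => (f : Ω → ℝ) x) ∈ boundedMeasurable S := by
      obtain ⟨hm, C, hC⟩ := f.2
      exact ⟨hm.comp measurable_subtype_coe, C, fun x => hC x⟩
    have he : (fun ν : SignedMeasure Ω => ∫ᵛ ω, (f : Ω → ℝ) ω ∂•ν) ∘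
        (fun ν : SignedMeasure S => ν.map Subtype.val) =
        fun ν : SignedMeasure S => ∫ᵛ x : S, (f : Ω → ℝ) x ∂•ν :=
      funext fun ν => (MeasurableEmbedding.subtype_coe hS).integral_map_vectorMeasure
    rw [he]
    exact continuous_iInf_dom (i := ⟨_, hf⟩) continuous_induced_dom
  exact @Continuous.comp _ _ _ (classicalWeakTopology S) (classicalWeakTopology Ω)
    (quantumWeakTopology H) _ _ hR h

theorem map_mem_probabilityMeasures {S : Set Ω} {ν : SignedMeasure S}
    (hν : ν ∈ probabilityMeasures S) : ν.map Subtype.val ∈ probabilityMeasures Ω := by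
  refine ⟨fun E hE => ?_, ?_⟩
  · rw [VectorMeasure.map_apply _ measurable_subtype_coe hE]
    exact hν.1 _ (measurable_subtype_coe hE)
  · rw [VectorMeasure.map_apply _ measurable_subtype_coe .univ, Set.preimage_univ]
    exact hν.2

end Reduction
end ClassicalExtension

theorem mainTheorem2 {H : Type*} [NormedAddCommGroup H] [InnerProductSpace ℂ H] [CompleteSpace H]
    [SeparableSpace H] [Nontrivial H] {Ω : Type*} [MeasurableSpace Ω]
    (R : SignedMeasure Ω →ₗ[ℝ] TraceClassSA H) (hR : IsReductionMap R) :
    ∃ hm : MeasurableSet (pureSet R),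
      IsReductionMap (restrictedMap R hm) ∧
      Set.range (fun ω : pureSet R => restrictedMap R hm (dirac ω)) = pureStates H := by
  have hm := measurableSet_pureSet hR
  have hp : ∀ P ∈ pureStates H, ∃ ω : pureSet R, restrictedMap R hm (dirac ω) = P := by
    intro P hP
    obtain ⟨ω, rfl⟩ := exists_map_dirac_eq hR hP
    exact ⟨⟨ω, hP⟩, restrictedMap_dirac R hm ⟨ω, hP⟩⟩
  have hc := continuous_restrictedMap hR.continuous hm
  refine ⟨hm, ⟨Set.Subset.antisymm ?_ (densityOperators_subset_image hc hp), hc⟩,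
    Set.Subset.antisymm ?_ fun P hP => hp P hP⟩
  · rintro _ ⟨ν, hν, rfl⟩
    rw [restrictedMap_apply, ← hR.image_eq]
    exact Set.mem_image_of_mem R (map_mem_probabilityMeasures hν)
  · rintro _ ⟨ω, rfl⟩
    change restrictedMap R hm (dirac ω) ∈ _
    rw [restrictedMap_dirac]
    exact ω.2
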